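/- Let $(\Omega,\mathcal F,\mathbb P)$ be an atomless probability space, and let $L^1$ be the set of integrable real random variables on it. For $X,Y\in L^1$ write $X\le_{\rm cx}Y$ if $\mathbb E[u(X)]\le\mathbb E[u(Y)]$ for all convex $u:\mathbb R\to\mathbb R$, and $X\ge_{\rm ssd}Y$ if $\mathbb E[u(X)]\ge\mathbb E[u(Y)]$ for all increasing (in the non-strict sense) concave $u:\mathbb R\to\mathbb R$; here expectations may take the value $+\infty$ (convex $u$) or $-\infty$ (concave $u$). Write $\buildrel \mathrm d\over=$ for equality in distribution. Then for any $X,Y\in L^1$ the following are equivalent. (i) $X\le_{\rm cx}Y$; (ii) $X\ge_{\rm ssd}Y$ and $\mathbb E[X]=\mathbb E[Y]$; (iii) $Y\buildrel \mathrm d\over=W+Z$ for some $W,Z\in L^1$ such that $W\buildrel \mathrm d\over=X$ and $\mathbb E[Z\mid W]=0$ almost surely; (iv) $Y\buildrel \mathrm d\over=W+Z$ for some $W,Z\in L^1$ such that $W\buildrel \mathrm d\over=X$, $\mathbb E[Z]=0$, and $\mathbb E[Z\mid W\le x]\le 0$ for all $x\in\mathbb R$ with $\mathbb P(W\le x)>0$;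 (v) $Y\buildrel \mathrm d\over=W+Z$ for some $W,Z\in L^1$ such that $W\buildrel \mathrm d\over=X$, $\mathbb E[Z]=0$, and $\mathbb E[Z\mid W\ge x]\ge 0$ for all $x\in\mathbb R$ with $\mathbb P(W\ge x)>0$. -/

import Mathlib

open MeasureTheory ProbabilityTheory

/-- The measure `μ` is atomless: every measurable set of positive measure has a measurable subset
of strictly smaller positive measure. -/
def Atomless {Ω : Type*} [MeasurableSpace Ω] (μ : Measure Ω) : Prop :=
  ∀ A : Set Ω, MeasurableSet A → 0 < μ A →
    ∃ B : Set Ω, B ⊆ A ∧ MeasurableSet B ∧ 0 < μ B ∧ μ B < μ A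

/-- `X` is an integrable (real-valued) random variable. -/
def InL1 {Ω : Type*} [MeasurableSpace Ω] (μ : Measure Ω) (X : Ω → ℝ) : Prop :=
  Measurable X ∧ Integrable X μ

/-- The expectation of `f` with values in `[-∞, ∞]`, namely `E[f⁺] - E[f⁻]`. It is meaningful
whenever one of the two parts is integrable, in particular for `f = u ∘ X` with `X` integrable and
`u` convex or concave on `ℝ` (such a `u` has an affine minorant or majorant). -/
noncomputable def extExpectation {Ω : Type*} [MeasurableSpace Ω] (μ : Measure Ω) (f : Ω → ℝ) :
    EReal :=
  ((∫⁻ ω, ENNReal.ofReal (f ω) ∂μ : ENNReal) : EReal) -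
    ((∫⁻ ω, ENNReal.ofReal (-f ω) ∂μ : ENNReal) : EReal)

/-- `X ≥_ssd Y`: `E[u(X)] ≥ E[u(Y)]` for all increasing (non-strictly) concave `u : ℝ → ℝ`. -/
def SSDGe {Ω : Type*} [MeasurableSpace Ω] (μ : Measure Ω) (X Y : Ω → ℝ) : Prop :=
  ∀ u : ℝ → ℝ, Monotone u → ConcaveOn ℝ Set.univ u →
    extExpectation μ (fun ω => u (Y ω)) ≤ extExpectation μ (fun ω => u (X ω))

/-- `X ≤_cx Y`: `E[u(X)] ≤ E[u(Y)]` for all convex `u : ℝ → ℝ`. -/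
def CxLe {Ω : Type*} [MeasurableSpace Ω] (μ : Measure Ω) (X Y : Ω → ℝ) : Prop :=
  ∀ u : ℝ → ℝ, ConvexOn ℝ Set.univ u →
    extExpectation μ (fun ω => u (X ω)) ≤ extExpectation μ (fun ω => u (Y ω))

/-- The elementary conditional expectation `E[Z | A]` given an event `A` of positive probability:
the mean of `Z` under the conditional probability measure `μ(· | A)`. -/
noncomputable def condExpEvent {Ω : Type*} [MeasurableSpace Ω] (μ : Measure Ω) (Z : Ω → ℝ)
    (A : Set Ω) : ℝ :=
  ∫ ω, Z ω ∂(ProbabilityTheory.cond μ A)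

/-- The conditional expectation `E[Z | W]` given the σ-algebra generated by `W`. -/
noncomputable def condExpGiven {Ω : Type*} [MeasurableSpace Ω] (μ : Measure Ω) (Z W : Ω → ℝ) :
    Ω → ℝ :=
  MeasureTheory.condExp (MeasurableSpace.comap W (inferInstance : MeasurableSpace ℝ)) μ Z

/-!
All five conditions are compared with one more: `X` and `Y` have equal means, and `E[(k - X)⁺] ≤
E[(k - Y)⁺]` for all `k` (the order of expected shortfalls). The first condition implies the second,
which gives the shortfall order by testing with `t ↦ -(k - t)⁺`, an increasing concave function. The
fourth and the fifth give it because `(k - W)⁺ ≤ (k - W - Z)⁺ + 1_A Z` for `A = {W ≤ k}` or `A = {W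
< k}` (`integral_shortfall_le_add`). Conversely a martingale pair satisfies the first condition by
the conditional Jensen inequality (`cxLe_add_of_condExpGiven_eq_zero`), and the fourth and fifth
since `Z` has mean zero on every event `{W ∈ S}`.

What remains is Strassen's theorem on the line: the shortfall order yields a martingale pair
(`exists_martingale_coupling`). Let `x` and `y` be the quantile functions of the two laws, on the
unit interval with Lebesgue measure. The shortfall order says that `∫₀ᵗ (x - y) ≥ 0`, with equality
at `t = 1`. So the measure `(x - y)⁺ du` can be coupled with `(y - x)⁺ dv` such that `u ≤ v`
(`exists_ordered_coupling`). For a coupled pair, `y u < x u ≤ x v < y v`, and the two points `x u`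
and `x v` can be split onto the common end points `y u` and `y v` while keeping their means. With
the weights dictated by the coupling they swap equal masses, so the second marginal is still the law
of `y` (`exchangeLaw`). This is an inverse transform martingale coupling in the sense of Jourdain
and Margheriti.

The law so found on `ℝ × ℝ` is realized on the given space since an atomless space carries a uniform
variable (`Atomless.exists_uniform`), which is read off from a maximal chain of events.
-/

/-! ### A uniform random variable on an atomless space -/

section UniformVariable

open Set Filter Topology
open scoped unitInterval

variable {Ω : Type*} [MeasurableSpace Ω] {μ : Measure Ω}

/-- The strict order on measurable sets in which the larger set must also have larger measure.
Maximal chains of this relation carry no two sets of the same measure. -/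
def StrictMeasureLT (μ : Measure Ω) (A B : Set Ω) : Prop :=
  MeasurableSet A ∧ MeasurableSet B ∧ A ⊆ B ∧ μ A < μ B

namespace StrictMeasureLT

lemma subset_of_measure_le {M : Set (Set Ω)} (hM : IsMaxChain (StrictMeasureLT μ) M)
    {C D : Set Ω} (hC : C ∈ M) (hD : D ∈ M) (h : μ C ≤ μ D) : C ⊆ D := by
  by_cases hCD : C = D
  · exact hCD.subset
  rcases hM.1 hC hD hCD with h1 | h1
  · exact h1.2.2.1
  · exact absurd h1.2.2.2 (not_lt.2 h)

/-- A set comparable with a maximal chain has the measure of some member of the chain. -/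
lemma exists_mem_measure_eq {M : Set (Set Ω)} (hM : IsMaxChain (StrictMeasureLT μ) M)
    (hmeas : ∀ C ∈ M, MeasurableSet C) {A : Set Ω} (hA : MeasurableSet A)
    (hlt : ∀ C ∈ M, μ C < μ A → C ⊆ A) (hgt : ∀ C ∈ M, μ A < μ C → A ⊆ C) :
    ∃ B ∈ M, μ B = μ A := by
  by_contra! hne
  have hchain : IsChain (StrictMeasureLT μ) (insert A M) := by
    refine hM.1.insert fun C hC _ => ?_
    rcases lt_or_gt_of_ne (hne C hC) with h | h
    · exact Or.inr ⟨hmeas C hC, hA, hlt C hC h, h⟩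
    · exact Or.inl ⟨hA, hmeas C hC, hgt C hC h, h⟩
  have := hM.2 hchain (subset_insert A M)
  exact hne A (this ▸ mem_insert A M) rfl

/-- The measures of the members of a maximal chain below a level have a maximum. -/
lemma exists_greatest_le {M : Set (Set Ω)} (hM : IsMaxChain (StrictMeasureLT μ) M)
    (hmeas : ∀ C ∈ M, MeasurableSet C) (h0 : ∅ ∈ M) (t : ENNReal) :
    ∃ A ∈ M, μ A ≤ t ∧ ∀ C ∈ M, μ C ≤ t → μ C ≤ μ A := by
  set S : Set ENNReal := {v | ∃ C ∈ M, μ C = v ∧ v ≤ t} with hS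
  have hSne : S.Nonempty := ⟨0, ∅, h0, measure_empty, zero_le⟩
  obtain ⟨u, hu, hlim, huS⟩ := exists_seq_tendsto_sSup hSne (OrderTop.bddAbove S)
  choose C hCM hCu hCt using huS
  have hCmono : Monotone C := fun m n hmn =>
    subset_of_measure_le hM (hCM m) (hCM n) (by rw [hCu, hCu]; exact hu hmn)
  have hA : μ (⋃ n, C n) = sSup S := by
    refine tendsto_nhds_unique (tendsto_measure_iUnion_atTop hCmono) ?_
    simpa [Function.comp_def, hCu] using hlim
  obtain ⟨A, hAM, hAeq⟩ := exists_mem_measure_eq hM hmeas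
    (MeasurableSet.iUnion fun n => hmeas _ (hCM n))
    (fun D hD hlt => by
      rw [hA] at hlt
      obtain ⟨n, hn⟩ := (hlim.eventually_const_lt hlt).exists
      exact (subset_of_measure_le hM hD (hCM n) (by rw [hCu]; exact hn.le)).trans
        (subset_iUnion C n))
    (fun D hD hlt => iUnion_subset fun n =>
      subset_of_measure_le hM (hCM n) hD ((measure_mono (subset_iUnion C n)).trans hlt.le))
  rw [hA] at hAeq
  refine ⟨A, hAM, ?_, fun D hD hDt => ?_⟩
  · rw [hAeq]
    exact sSup_le (by rintro _ ⟨_, _, _, h⟩; exact h)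
  · rw [hAeq]
    exact le_sSup ⟨D, hD, rfl, hDt⟩

/-- The measures of the members of a maximal chain above a level have a minimum. -/
lemma exists_least_ge [IsFiniteMeasure μ] {M : Set (Set Ω)}
    (hM : IsMaxChain (StrictMeasureLT μ) M)
    (hmeas : ∀ C ∈ M, MeasurableSet C) (h1 : univ ∈ M) {t : ENNReal} (ht : t ≤ μ univ) :
    ∃ A ∈ M, t ≤ μ A ∧ ∀ C ∈ M, t ≤ μ C → μ A ≤ μ C := by
  set S : Set ENNReal := {v | ∃ C ∈ M, μ C = v ∧ t ≤ v} with hS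
  have hSne : S.Nonempty := ⟨μ univ, univ, h1, rfl, ht⟩
  obtain ⟨u, hu, hlim, huS⟩ := exists_seq_tendsto_sInf hSne (OrderBot.bddBelow S)
  choose C hCM hCu hCt using huS
  have hCmono : Antitone C := fun m n hmn =>
    subset_of_measure_le hM (hCM n) (hCM m) (by rw [hCu, hCu]; exact hu hmn)
  have hA : μ (⋂ n, C n) = sInf S := by
    refine tendsto_nhds_unique (tendsto_measure_iInter_atTop
      (fun n => (hmeas _ (hCM n)).nullMeasurableSet) hCmono ⟨0, measure_ne_top _ _⟩) ?_
    simpa [Function.comp_def, hCu] using hlim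
  obtain ⟨A, hAM, hAeq⟩ := exists_mem_measure_eq hM hmeas
    (MeasurableSet.iInter fun n => hmeas _ (hCM n))
    (fun D hD hlt => subset_iInter fun n =>
      subset_of_measure_le hM hD (hCM n) (hlt.le.trans (measure_mono (iInter_subset C n))))
    (fun D hD hlt => by
      rw [hA] at hlt
      obtain ⟨n, hn⟩ := (hlim.eventually_lt_const hlt).exists
      exact (iInter_subset C n).trans
        (subset_of_measure_le hM (hCM n) hD (by rw [hCu]; exact hn.le)))
  rw [hA] at hAeq
  refine ⟨A, hAM, ?_, fun D hD hDt => ?_⟩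
  · rw [hAeq]
    exact le_sInf (by rintro _ ⟨_, _, _, h⟩; exact h)
  · rw [hAeq]
    exact sInf_le ⟨D, hD, rfl, hDt⟩

end StrictMeasureLT

open StrictMeasureLT in
/-- On an atomless probability space there is an increasing family of measurable sets of which the
`t`-th has measure `t`: a maximal chain cannot have a gap in its measures, as part of the
difference between the two sets at its ends could be added to the smaller one. -/
lemma Atomless.exists_monotone_measure_eq [IsProbabilityMeasure μ] (hμ : Atomless μ) :
    ∃ B : I → Set Ω, (∀ t, MeasurableSet (B t)) ∧ Monotone B ∧
      ∀ t, μ (B t) = ENNReal.ofReal t := by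
  have h01 : IsChain (StrictMeasureLT μ) {∅, univ} :=
    IsChain.pair ⟨MeasurableSet.empty, MeasurableSet.univ, empty_subset _, by simp⟩
  obtain ⟨M, hM, hsub⟩ := h01.exists_maxChain
  have h0 : ∅ ∈ M := hsub (by simp)
  have h1 : univ ∈ M := hsub (by simp)
  have hmeas : ∀ C ∈ M, MeasurableSet C := fun C hC => by
    by_cases h : C = ∅
    · simp [h]
    rcases hM.1 hC h0 h with h | h
    exacts [h.1, h.2.1]
  have key : ∀ t : I, ∃ B ∈ M, μ B = ENNReal.ofReal t := by
    intro t
    by_contra! hne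
    have ht1 : ENNReal.ofReal t ≤ μ univ := by simpa using t.2.2
    obtain ⟨A, hA, hAt, hAmax⟩ := exists_greatest_le hM hmeas h0 (ENNReal.ofReal t)
    obtain ⟨B, hB, hBt, hBmin⟩ := exists_least_ge hM hmeas h1 ht1
    have hAt' := lt_of_le_of_ne hAt (hne A hA)
    have hBt' := lt_of_le_of_ne hBt (hne B hB).symm
    have hAB : A ⊆ B := subset_of_measure_le hM hA hB (hAt.trans hBt)
    have hdiff : μ (B \ A) = μ B - μ A :=
      measure_sdiff hAB (hmeas A hA).nullMeasurableSet (measure_ne_top _ _)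
    obtain ⟨D, hDs, hDm, hD0, hD1⟩ := hμ (B \ A) ((hmeas B hB).diff (hmeas A hA))
      (by rw [hdiff]; exact tsub_pos_of_lt (hAt'.trans hBt'))
    have hdisj : Disjoint A D := disjoint_left.2 fun ω h1 h2 => (hDs h2).2 h1
    have hU : μ (A ∪ D) = μ A + μ D := measure_union hdisj hDm
    have hgtA : μ A < μ (A ∪ D) := by
      rw [hU]; exact ENNReal.lt_add_right (measure_ne_top _ _) hD0.ne'
    have hltB : μ (A ∪ D) < μ B := by
      rw [hU]
      calc μ A + μ D < μ A + μ (B \ A) := by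
            exact ENNReal.add_lt_add_left (measure_ne_top _ _) hD1
        _ = μ B := by rw [hdiff]; exact add_tsub_cancel_of_le (measure_mono hAB)
    obtain ⟨E, hE, hEeq⟩ := exists_mem_measure_eq hM hmeas ((hmeas A hA).union hDm)
      (fun C hC hlt => by
        rcases le_total (μ C) (ENNReal.ofReal t) with h | h
        · exact (subset_of_measure_le hM hC hA (hAmax C hC h)).trans subset_union_left
        · exact absurd (hBmin C hC h) (not_le.2 (hlt.trans hltB)))
      (fun C hC hlt => by
        rcases le_total (μ C) (ENNReal.ofReal t) with h | h
        · exact absurd (hAmax C hC h) (not_le.2 (hgtA.trans hlt))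
        · exact (union_subset hAB (hDs.trans sdiff_subset)).trans
            (subset_of_measure_le hM hB hC (hBmin C hC h)))
    rcases le_total (μ E) (ENNReal.ofReal t) with h | h
    · exact absurd (hAmax E hE h) (not_le.2 (hEeq ▸ hgtA))
    · exact absurd (hBmin E hE h) (not_le.2 (hEeq ▸ hltB))
  choose B hBM hBeq using key
  refine ⟨B, fun t => hmeas _ (hBM t), fun s t hst => ?_, hBeq⟩
  refine subset_of_measure_le hM (hBM s) (hBM t) ?_
  rw [hBeq, hBeq]
  exact ENNReal.ofReal_le_ofReal hst

/-- An atomless probability space carries a random variable uniform on the unit interval. -/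
lemma Atomless.exists_uniform [IsProbabilityMeasure μ] (hμ : Atomless μ) :
    ∃ U : Ω → I, Measurable U ∧ μ.map U = volume := by
  obtain ⟨B, hBm, hBmono, hBeq⟩ := hμ.exists_monotone_measure_eq
  let U : Ω → I := fun ω => sInf {t | ω ∈ B t}
  have hUle : ∀ {t ω}, ω ∈ B t → U ω ≤ t := fun h => sInf_le (mem_ofPred_eq.symm ▸ h)
  have hlt : ∀ t, {ω | U ω < t} = ⋃ s ∈ {s : I | s < t}, B s := by
    intro t
    ext ω
    simp only [U, sInf_lt_iff, mem_ofPred_eq, mem_iUnion, exists_prop]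
    exact ⟨fun ⟨s, h1, h2⟩ => ⟨s, h2, h1⟩, fun ⟨s, h1, h2⟩ => ⟨s, h2, h1⟩⟩
  have hU : Measurable U := by
    refine measurable_of_Iio fun t => ?_
    obtain ⟨D, hDc, hDd⟩ := TopologicalSpace.exists_countable_dense I
    have : U ⁻¹' Iio t = ⋃ s ∈ D ∩ Iio t, B s := by
      ext ω
      simp only [mem_preimage, mem_Iio, mem_iUnion, mem_inter_iff, exists_prop]
      constructor
      · intro h
        obtain ⟨s, hs, h1, h2⟩ := hDd.exists_between h
        obtain ⟨r, hr, hrs⟩ := sInf_lt_iff.1 h1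
        exact ⟨s, ⟨hs, h2⟩, hBmono hrs.le hr⟩
      · rintro ⟨s, ⟨-, hs⟩, h⟩
        exact (hUle h).trans_lt hs
    rw [this]
    exact MeasurableSet.biUnion (hDc.mono inter_subset_left) fun s _ => hBm s
  refine ⟨U, hU, ?_⟩
  have : IsProbabilityMeasure (μ.map U) := Measure.isProbabilityMeasure_map hU.aemeasurable
  refine Measure.ext_of_Iic _ _ fun t => ?_
  rw [Measure.map_apply hU measurableSet_Iic, unitInterval.volume_Iic]
  apply le_antisymm
  · refine le_of_forall_gt_imp_ge_of_dense fun a ha => ?_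
    rcases le_or_gt 1 a with h1 | h1
    · exact prob_le_one.trans h1
    have hta : (t : ℝ) < a.toReal :=
      (ENNReal.ofReal_lt_iff_lt_toReal t.2.1 h1.ne_top).1 ha
    let s : I := ⟨a.toReal, ENNReal.toReal_nonneg, by
      simpa using ENNReal.toReal_mono ENNReal.one_ne_top h1.le⟩
    have hs : μ (B s) = a := by rw [hBeq]; exact ENNReal.ofReal_toReal h1.ne_top
    rw [← hs]
    refine measure_mono fun ω (hω : U ω ≤ t) => ?_
    have : ω ∈ {ω | U ω < s} := lt_of_le_of_lt hω hta
    rw [hlt] at this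
    obtain ⟨r, hr, hωr⟩ := mem_iUnion₂.1 this
    exact hBmono (le_of_lt hr) hωr
  · rw [← hBeq]
    exact measure_mono fun ω hω => hUle hω

/-- Every probability law on a standard Borel space is the law of a random variable on a given
atomless probability space. -/
lemma Atomless.exists_map_eq [IsProbabilityMeasure μ] (hμ : Atomless μ)
    {E : Type*} [MeasurableSpace E] [StandardBorelSpace E] [Nonempty E]
    (π : Measure E) [IsProbabilityMeasure π] :
    ∃ f : Ω → E, Measurable f ∧ μ.map f = π := by
  obtain ⟨U, hU, hUμ⟩ := hμ.exists_uniform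
  obtain ⟨g, hg, hgπ⟩ := π.exists_measurable_map_eq
  exact ⟨g ∘ U, hg.comp hU, by rw [← Measure.map_map hg hU, hUμ, hgπ]⟩

end UniformVariable

/-! ### Quantile functions -/

section Quantile

open Set Filter Topology

/-- The uniform distribution on the open unit interval. -/
noncomputable def unifIoo : Measure ℝ := volume.restrict (Ioo 0 1)

instance : IsProbabilityMeasure unifIoo := ⟨by simp [unifIoo]⟩

lemma ae_unifIoo_mem : ∀ᵐ w ∂unifIoo, w ∈ Ioo (0 : ℝ) 1 := ae_restrict_mem measurableSet_Ioo

lemma unifIoo_Iic {t : ℝ} (h1 : t ≤ 1) : unifIoo (Iic t) = ENNReal.ofReal t := by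
  rw [unifIoo, Measure.restrict_congr_set Ioo_ae_eq_Ioc, Measure.restrict_apply measurableSet_Iic,
    Iic_inter_Ioc_of_le h1]
  simp

open Classical in
/-- The left-continuous quantile function of a probability measure on `ℝ`, set to `0` outside the
open unit interval so that it is measurable on the whole line. -/
noncomputable def quantile (P : Measure ℝ) (w : ℝ) : ℝ :=
  if w ∈ Ioo (0 : ℝ) 1 then sInf {t | w ≤ cdf P t} else 0

variable {P : Measure ℝ} {w w' t : ℝ}

/-- The Galois connection between the quantile function and the distribution function. -/
lemma quantile_le_iff (hw : w ∈ Ioo (0 : ℝ) 1) : quantile P w ≤ t ↔ w ≤ cdf P t := by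
  rw [quantile, if_pos hw]
  have hbdd : BddBelow {t | w ≤ cdf P t} := by
    obtain ⟨b, hb⟩ := ((tendsto_cdf_atBot P).eventually_lt_const hw.1).exists
    refine ⟨b, fun s hs => ?_⟩
    by_contra! h
    exact absurd (hs.trans (monotone_cdf P h.le)) (not_le.2 hb)
  have hne : {t | w ≤ cdf P t}.Nonempty :=
    ((tendsto_cdf_atTop P).eventually_const_lt hw.2).exists.imp fun _ h => le_of_lt h
  refine ⟨fun h => ?_, fun h => csInf_le hbdd h⟩
  have hright : Tendsto (cdf P) (𝓝[>] t) (𝓝 (cdf P t)) :=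
    ((cdf P).right_continuous t).mono_left (nhdsWithin_mono _ Ioi_subset_Ici_self)
  refine ge_of_tendsto hright ?_
  filter_upwards [self_mem_nhdsWithin] with s hs
  obtain ⟨r, hr, hrs⟩ := exists_lt_of_csInf_lt hne (h.trans_lt hs)
  exact le_trans hr (monotone_cdf P hrs.le)

lemma quantile_monotoneOn (P : Measure ℝ) : MonotoneOn (quantile P) (Ioo 0 1) :=
  fun _ ha _ hb hab => (quantile_le_iff ha).2 (hab.trans ((quantile_le_iff hb).1 le_rfl))

lemma measurable_quantile (P : Measure ℝ) : Measurable (quantile P) := by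
  refine measurable_of_Iic fun t => ?_
  have : quantile P ⁻¹' Iic t =
      (Ioo 0 1 ∩ Iic (cdf P t)) ∪ ((Ioo 0 1)ᶜ ∩ {_w | 0 ≤ t}) := by
    ext w
    by_cases hw : w ∈ Ioo (0 : ℝ) 1
    · simp only [mem_preimage, mem_Iic, quantile_le_iff hw, mem_union, mem_inter_iff, hw,
        mem_compl_iff, true_and, not_true, false_and, or_false]
    · simp only [mem_preimage, mem_Iic, quantile, mem_union, mem_inter_iff, hw,
        mem_compl_iff, true_and, not_false_iff, false_and, false_or, if_false, mem_ofPred_eq]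
  rw [this]
  exact (measurableSet_Ioo.inter measurableSet_Iic).union
    (measurableSet_Ioo.compl.inter (MeasurableSet.const _))

lemma map_quantile (P : Measure ℝ) [IsProbabilityMeasure P] : unifIoo.map (quantile P) = P := by
  have : IsProbabilityMeasure (unifIoo.map (quantile P)) :=
    Measure.isProbabilityMeasure_map (measurable_quantile P).aemeasurable
  refine Measure.ext_of_Iic _ _ fun t => ?_
  rw [Measure.map_apply (measurable_quantile P) measurableSet_Iic, ← ofReal_cdf P t,
    ← unifIoo_Iic (cdf_le_one P t)]
  refine measure_congr ?_
  filter_upwards [ae_unifIoo_mem] with w hw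
  exact propext (quantile_le_iff hw)

/-- The quantile coupling of two finite measures of equal mass: if the first is stochastically
smaller, the coupling is carried by the half-plane above the diagonal. -/
lemma exists_ordered_coupling (α β : Measure ℝ) [IsFiniteMeasure α] [IsFiniteMeasure β]
    (hmass : α univ = β univ) (hle : ∀ t, β (Iic t) ≤ α (Iic t)) :
    ∃ σ : Measure (ℝ × ℝ), σ.map Prod.fst = α ∧ σ.map Prod.snd = β ∧ ∀ᵐ p ∂σ, p.1 ≤ p.2 := by
  by_cases hα : α univ = 0
  · have hβ : β univ = 0 := hmass ▸ hα
    rw [Measure.measure_univ_eq_zero] at hα hβ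
    exact ⟨0, by simp [hα], by simp [hβ], by simp⟩
  have hα0 : NeZero α := ⟨fun h => hα (by simp [h])⟩
  have hβ0 : NeZero β := ⟨fun h => hα (by simp [hmass, h])⟩
  set T := α univ with hT
  have hTtop : T ≠ ⊤ := measure_ne_top _ _
  have hPα : IsProbabilityMeasure (T⁻¹ • α) :=
    ⟨ENNReal.inv_mul_cancel hα hTtop⟩
  have hPβ : IsProbabilityMeasure (T⁻¹ • β) :=
    ⟨by simp [← hmass, ENNReal.inv_mul_cancel hα hTtop]⟩
  set a := quantile (T⁻¹ • α)
  set b := quantile (T⁻¹ • β)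
  have ha : Measurable a := measurable_quantile _
  have hb : Measurable b := measurable_quantile _
  refine ⟨T • unifIoo.map fun w => (a w, b w), ?_, ?_, ?_⟩
  · rw [Measure.map_smul, Measure.map_map measurable_fst (ha.prodMk hb)]
    change T • unifIoo.map a = α
    rw [map_quantile, smul_smul, ENNReal.mul_inv_cancel hα hTtop, one_smul]
  · rw [Measure.map_smul, Measure.map_map measurable_snd (ha.prodMk hb)]
    change T • unifIoo.map b = β
    rw [map_quantile, smul_smul, ENNReal.mul_inv_cancel hα hTtop, one_smul]
  · refine Measure.ae_smul_measure ?_ T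
    rw [ae_map_iff (ha.prodMk hb).aemeasurable (measurableSet_le measurable_fst measurable_snd)]
    filter_upwards [ae_unifIoo_mem] with w hw
    change a w ≤ b w
    rw [quantile_le_iff hw]
    have h1 : w ≤ cdf (T⁻¹ • β) (b w) := (quantile_le_iff hw).1 le_rfl
    refine h1.trans ?_
    rw [cdf_eq_real, cdf_eq_real]
    refine ENNReal.toReal_mono (measure_ne_top _ _) ?_
    simp only [Measure.smul_apply, smul_eq_mul]
    gcongr T⁻¹ * ?_
    exact hle _

end Quantile

/-! ### Martingale couplings of quantile functions -/

section Coupling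

open Set Filter Topology

lemma integral_nonpos_iff_lintegral_le {E : Type*} [MeasurableSpace E] {ν : Measure E}
    {f : E → ℝ} (hf : Integrable f ν) :
    ∫ a, f a ∂ν ≤ 0 ↔ ∫⁻ a, ENNReal.ofReal (f a) ∂ν ≤ ∫⁻ a, ENNReal.ofReal (-f a) ∂ν := by
  rw [integral_eq_lintegral_pos_part_sub_lintegral_neg_part hf, sub_nonpos]
  exact ENNReal.toReal_le_toReal hf.lintegral_lt_top.ne hf.neg.lintegral_lt_top.ne

lemma integral_eq_zero_iff_lintegral_eq {E : Type*} [MeasurableSpace E] {ν : Measure E}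
    {f : E → ℝ} (hf : Integrable f ν) :
    ∫ a, f a ∂ν = 0 ↔ ∫⁻ a, ENNReal.ofReal (f a) ∂ν = ∫⁻ a, ENNReal.ofReal (-f a) ∂ν := by
  rw [integral_eq_lintegral_pos_part_sub_lintegral_neg_part hf, sub_eq_zero]
  exact ENNReal.toReal_eq_toReal_iff' hf.lintegral_lt_top.ne hf.neg.lintegral_lt_top.ne

/-- Lower partial means of quantile functions are ordered if expected shortfalls are. At the level
`t` the relevant threshold for the shortfall is `k = quantile Q t`. -/
lemma setIntegral_quantile_sub_nonpos {P Q : Measure ℝ}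
    (hP : Integrable (quantile P) unifIoo) (hQ : Integrable (quantile Q) unifIoo)
    (hput : ∀ k, ∫ w, max (k - quantile P w) 0 ∂unifIoo ≤ ∫ w, max (k - quantile Q w) 0 ∂unifIoo)
    {t : ℝ} (ht : t ∈ Ioo (0 : ℝ) 1) :
    ∫ w in Iic t, (quantile Q w - quantile P w) ∂unifIoo ≤ 0 := by
  set k := quantile Q t
  have hPk : Integrable (fun w => max (k - quantile P w) 0) unifIoo :=
    ((integrable_const k).sub hP).pos_part
  have hQk : Integrable (fun w => max (k - quantile Q w) 0) unifIoo :=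
    ((integrable_const k).sub hQ).pos_part
  rw [← integral_indicator measurableSet_Iic]
  calc _ ≤ ∫ w, (max (k - quantile P w) 0 - max (k - quantile Q w) 0) ∂unifIoo := by
        refine integral_mono_ae ((hQ.sub hP).indicator measurableSet_Iic) (hPk.sub hQk) ?_
        filter_upwards [ae_unifIoo_mem] with w hw
        by_cases hwt : w ≤ t
        · have h1 : quantile Q w ≤ k := quantile_monotoneOn Q hw ht hwt
          simp only [indicator, mem_Iic, hwt, if_true]
          rw [max_eq_left (sub_nonneg.2 h1)]
          linarith [le_max_left (k - quantile P w) 0]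
        · have h1 : k ≤ quantile Q w := quantile_monotoneOn Q ht hw (not_le.1 hwt).le
          simp only [indicator, mem_Iic, hwt, if_false]
          rw [max_eq_right (sub_nonpos.2 h1), sub_zero]
          exact le_max_right _ _
    _ ≤ 0 := by
        rw [integral_sub hPk hQk]
        exact sub_nonpos.2 (hput k)

/-- Mass lost by `quantile P` relative to `quantile Q` can be matched with mass gained at higher
levels. -/
lemma exists_coupling_excess {P Q : Measure ℝ}
    (hP : Integrable (quantile P) unifIoo) (hQ : Integrable (quantile Q) unifIoo)
    (hmean : ∫ w, quantile P w ∂unifIoo = ∫ w, quantile Q w ∂unifIoo)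
    (hput : ∀ k, ∫ w, max (k - quantile P w) 0 ∂unifIoo ≤
      ∫ w, max (k - quantile Q w) 0 ∂unifIoo) :
    ∃ σ : Measure (ℝ × ℝ),
      σ.map Prod.fst = unifIoo.withDensity
        (fun u => ENNReal.ofReal (quantile P u - quantile Q u)) ∧
      σ.map Prod.snd = unifIoo.withDensity
        (fun u => ENNReal.ofReal (quantile Q u - quantile P u)) ∧ ∀ᵐ p ∂σ, p.1 ≤ p.2 := by
  set x := quantile P
  set y := quantile Q
  have hyx : Integrable (fun w => y w - x w) unifIoo := hQ.sub hP
  have hα : IsFiniteMeasure (unifIoo.withDensity fun u => ENNReal.ofReal (x u - y u)) :=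
    isFiniteMeasure_withDensity (hP.sub hQ).lintegral_lt_top.ne
  have hβ : IsFiniteMeasure (unifIoo.withDensity fun u => ENNReal.ofReal (y u - x u)) :=
    isFiniteMeasure_withDensity hyx.lintegral_lt_top.ne
  have hmass : (unifIoo.withDensity fun u => ENNReal.ofReal (x u - y u)) univ =
      (unifIoo.withDensity fun u => ENNReal.ofReal (y u - x u)) univ := by
    rw [withDensity_apply _ MeasurableSet.univ, withDensity_apply _ MeasurableSet.univ,
      Measure.restrict_univ]
    have h0 : ∫ w, (y w - x w) ∂unifIoo = 0 := by
      rw [integral_sub hQ hP, hmean, sub_self]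
    simpa using ((integral_eq_zero_iff_lintegral_eq hyx).1 h0).symm
  refine exists_ordered_coupling _ _ hmass fun t => ?_
  rcases le_or_gt t 0 with ht0 | ht0
  · have : unifIoo (Iic t) = 0 := by
      rw [unifIoo_Iic (ht0.trans zero_le_one), ENNReal.ofReal_eq_zero.2 ht0]
    rw [withDensity_absolutelyContinuous _ _ this]
    exact zero_le
  rcases lt_or_ge t 1 with ht1 | ht1
  · rw [withDensity_apply _ measurableSet_Iic, withDensity_apply _ measurableSet_Iic]
    simpa using (integral_nonpos_iff_lintegral_le hyx.restrict).1
      (setIntegral_quantile_sub_nonpos hP hQ hput ⟨ht0, ht1⟩)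
  · have h : (Iic t : Set ℝ) =ᵐ[unifIoo] univ := by
      filter_upwards [ae_unifIoo_mem] with w hw
      exact propext ⟨fun _ => trivial, fun _ => hw.2.le.trans ht1⟩
    rw [measure_congr ((withDensity_absolutelyContinuous _ _).ae_eq h), ← hmass]
    rw [measure_congr ((withDensity_absolutelyContinuous _ _).ae_eq h)]

/-- The joint law of a pair moving the first quantile function `x` to the second one `y`, built from
a matching `σ` of levels `u` with `y u < x u` and levels `v` with `x v < y v`. Where `x = y` nothing
moves. For a matched pair `(u, v)`, the points `x u` and `x v` lie in the interval from `y u` to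
`y v` and are each sent to the two ends of it, in the only proportions that keep the mean; the
normalization is such that `x u` and `x v` exchange equal amounts of their destinations `y u` and
`y v`, so that the total masses arriving there do not change. -/
noncomputable def exchangeLaw (ν : Measure ℝ) (σ : Measure (ℝ × ℝ)) (x y : ℝ → ℝ) :
    Measure (ℝ × ℝ) :=
  (ν.restrict {u | x u = y u}).map (fun u => (x u, y u)) +
  (σ.withDensity fun p => ENNReal.ofReal ((x p.1 - y p.1)⁻¹ - (y p.2 - y p.1)⁻¹)).map
    (fun p => (x p.1, y p.1)) +
  (σ.withDensity fun p => ENNReal.ofReal (y p.2 - y p.1)⁻¹).map (fun p => (x p.1, y p.2)) +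
  (σ.withDensity fun p => ENNReal.ofReal (y p.2 - y p.1)⁻¹).map (fun p => (x p.2, y p.1)) +
  (σ.withDensity fun p => ENNReal.ofReal ((y p.2 - x p.2)⁻¹ - (y p.2 - y p.1)⁻¹)).map
    (fun p => (x p.2, y p.2))

variable {ν : Measure ℝ} {σ : Measure (ℝ × ℝ)} {x y : ℝ → ℝ}

lemma lintegral_exchangeLaw (hx : Measurable x) (hy : Measurable y) {H : ℝ × ℝ → ENNReal}
    (hH : Measurable H) :
    ∫⁻ p, H p ∂exchangeLaw ν σ x y = ∫⁻ u in {u | x u = y u}, H (x u, y u) ∂ν +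
      ∫⁻ p, (ENNReal.ofReal ((x p.1 - y p.1)⁻¹ - (y p.2 - y p.1)⁻¹) * H (x p.1, y p.1) +
        ENNReal.ofReal (y p.2 - y p.1)⁻¹ * H (x p.1, y p.2) +
        ENNReal.ofReal (y p.2 - y p.1)⁻¹ * H (x p.2, y p.1) +
        ENNReal.ofReal ((y p.2 - x p.2)⁻¹ - (y p.2 - y p.1)⁻¹) * H (x p.2, y p.2)) ∂σ := by
  rw [exchangeLaw]
  simp only [lintegral_add_measure]
  rw [lintegral_map hH (by fun_prop), lintegral_map hH (by fun_prop),
    lintegral_map hH (by fun_prop), lintegral_map hH (by fun_prop), lintegral_map hH (by fun_prop),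
    lintegral_withDensity_eq_lintegral_mul _ (by fun_prop) (by fun_prop),
    lintegral_withDensity_eq_lintegral_mul _ (by fun_prop) (by fun_prop),
    lintegral_withDensity_eq_lintegral_mul _ (by fun_prop) (by fun_prop),
    lintegral_withDensity_eq_lintegral_mul _ (by fun_prop) (by fun_prop),
    lintegral_add_right _ (by fun_prop), lintegral_add_right _ (by fun_prop),
    lintegral_add_right _ (by fun_prop)]
  simp only [Pi.mul_apply, add_assoc]

lemma lintegral_withDensity_inv {f g : ℝ → ℝ} (hf : Measurable f) (hg : Measurable g)
    {Φ : ℝ → ENNReal} (hΦ : Measurable Φ) :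
    ∫⁻ u, ENNReal.ofReal (f u - g u)⁻¹ * Φ u
      ∂(ν.withDensity fun u => ENNReal.ofReal (f u - g u)) = ∫⁻ u in {u | g u < f u}, Φ u ∂ν := by
  rw [lintegral_withDensity_eq_lintegral_mul _ (by fun_prop) (by fun_prop),
    ← lintegral_indicator (measurableSet_lt hg hf)]
  refine lintegral_congr fun u => ?_
  by_cases h : g u < f u
  · have h' : 0 < f u - g u := sub_pos.2 h
    simp only [Pi.mul_apply, indicator, mem_ofPred_eq, h, if_true]
    rw [← mul_assoc, ← ENNReal.ofReal_mul h'.le, mul_inv_cancel₀ h'.ne', ENNReal.ofReal_one,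
      one_mul]
  · have h' : f u - g u ≤ 0 := sub_nonpos.2 (not_lt.1 h)
    simp [indicator, h, ENNReal.ofReal_eq_zero.2 h']

/-- Splitting an integral over levels according to which of the two quantile functions is larger,
and reading off the two parts where they differ from the matching. -/
lemma lintegral_eq_diagonal_add_matching (hx : Measurable x) (hy : Measurable y)
    (h1 : σ.map Prod.fst = ν.withDensity fun u => ENNReal.ofReal (x u - y u))
    (h2 : σ.map Prod.snd = ν.withDensity fun u => ENNReal.ofReal (y u - x u))
    {Φ : ℝ → ENNReal} (hΦ : Measurable Φ) :
    ∫⁻ u, Φ u ∂ν = ∫⁻ u in {u | x u = y u}, Φ u ∂ν +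
      ∫⁻ p, (ENNReal.ofReal (x p.1 - y p.1)⁻¹ * Φ p.1 +
        ENNReal.ofReal (y p.2 - x p.2)⁻¹ * Φ p.2) ∂σ := by
  have e1 := lintegral_withDensity_inv (ν := ν) hx hy hΦ
  have e2 := lintegral_withDensity_inv (ν := ν) hy hx hΦ
  rw [← h1, lintegral_map (by fun_prop) measurable_fst] at e1
  rw [← h2, lintegral_map (by fun_prop) measurable_snd] at e2
  rw [lintegral_add_right _ (by fun_prop), e1, e2,
    ← lintegral_add_compl Φ (measurableSet_eq_fun hx hy)]
  congr 1
  have hU : {u | x u = y u}ᶜ = {u | y u < x u} ∪ {u | x u < y u} := by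
    ext u
    exact ne_iff_lt_or_gt.trans or_comm
  rw [hU, lintegral_union (measurableSet_lt hx hy)]
  exact disjoint_left.2 fun u h h' => lt_asymm (α := ℝ) h h'

lemma ofReal_inv_sub_add {a b : ℝ} (ha : 0 < a) (hab : a ≤ b) :
    ENNReal.ofReal (a⁻¹ - b⁻¹) + ENNReal.ofReal b⁻¹ = ENNReal.ofReal a⁻¹ := by
  rw [← ENNReal.ofReal_add (sub_nonneg.2 (inv_anti₀ ha hab)) (inv_nonneg.2 (ha.le.trans hab)),
    sub_add_cancel]

lemma map_fst_exchangeLaw (hx : Measurable x) (hy : Measurable y)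
    (h1 : σ.map Prod.fst = ν.withDensity fun u => ENNReal.ofReal (x u - y u))
    (h2 : σ.map Prod.snd = ν.withDensity fun u => ENNReal.ofReal (y u - x u))
    (hσ : ∀ᵐ p ∂σ, y p.1 < x p.1 ∧ x p.1 ≤ x p.2 ∧ x p.2 < y p.2) :
    (exchangeLaw ν σ x y).map Prod.fst = ν.map x := by
  refine Measure.ext_of_lintegral _ fun h hh => ?_
  rw [lintegral_map hh measurable_fst, lintegral_map hh hx,
    lintegral_exchangeLaw hx hy (by fun_prop),
    lintegral_eq_diagonal_add_matching hx hy h1 h2 (Φ := fun u => h (x u)) (by fun_prop)]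
  congr 1
  refine lintegral_congr_ae ?_
  filter_upwards [hσ] with p ⟨hp1, hp2, hp3⟩
  rw [← ofReal_inv_sub_add (b := y p.2 - y p.1) (sub_pos.2 hp1) (by linarith),
    ← ofReal_inv_sub_add (b := y p.2 - y p.1) (sub_pos.2 hp3) (by linarith)]
  ring

lemma map_snd_exchangeLaw (hx : Measurable x) (hy : Measurable y)
    (h1 : σ.map Prod.fst = ν.withDensity fun u => ENNReal.ofReal (x u - y u))
    (h2 : σ.map Prod.snd = ν.withDensity fun u => ENNReal.ofReal (y u - x u))
    (hσ : ∀ᵐ p ∂σ, y p.1 < x p.1 ∧ x p.1 ≤ x p.2 ∧ x p.2 < y p.2) :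
    (exchangeLaw ν σ x y).map Prod.snd = ν.map y := by
  refine Measure.ext_of_lintegral _ fun h hh => ?_
  rw [lintegral_map hh measurable_snd, lintegral_map hh hy,
    lintegral_exchangeLaw hx hy (by fun_prop),
    lintegral_eq_diagonal_add_matching hx hy h1 h2 (Φ := fun u => h (y u)) (by fun_prop)]
  congr 1
  refine lintegral_congr_ae ?_
  filter_upwards [hσ] with p ⟨hp1, hp2, hp3⟩
  rw [← ofReal_inv_sub_add (b := y p.2 - y p.1) (sub_pos.2 hp1) (by linarith),
    ← ofReal_inv_sub_add (b := y p.2 - y p.1) (sub_pos.2 hp3) (by linarith)]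
  ring

/-- The exchange law balances gains against losses over every event in the first coordinate, which
is the martingale property of the pair. -/
lemma setLIntegral_exchangeLaw_balance (hx : Measurable x) (hy : Measurable y)
    (hσ : ∀ᵐ p ∂σ, y p.1 < x p.1 ∧ x p.1 ≤ x p.2 ∧ x p.2 < y p.2)
    {S : Set ℝ} (hS : MeasurableSet S) :
    ∫⁻ p in Prod.fst ⁻¹' S, ENNReal.ofReal (p.2 - p.1) ∂exchangeLaw ν σ x y =
      ∫⁻ p in Prod.fst ⁻¹' S, ENNReal.ofReal (p.1 - p.2) ∂exchangeLaw ν σ x y := by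
  have hS' : MeasurableSet (Prod.fst ⁻¹' S : Set (ℝ × ℝ)) := measurable_fst hS
  rw [← lintegral_indicator hS', ← lintegral_indicator hS',
    lintegral_exchangeLaw hx hy (Measurable.indicator (by fun_prop) hS'),
    lintegral_exchangeLaw hx hy (Measurable.indicator (by fun_prop) hS')]
  congr 1
  · refine setLIntegral_congr_fun (measurableSet_eq_fun hx hy) fun u (hu : x u = y u) => ?_
    simp [hu, indicator]
  refine lintegral_congr_ae ?_
  filter_upwards [hσ] with p ⟨hp1, hp2, hp3⟩
  have hb : 0 < y p.2 - y p.1 := by linarith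
  have key1 : ENNReal.ofReal (y p.2 - y p.1)⁻¹ * ENNReal.ofReal (y p.2 - x p.1) =
      ENNReal.ofReal ((x p.1 - y p.1)⁻¹ - (y p.2 - y p.1)⁻¹) * ENNReal.ofReal (x p.1 - y p.1) := by
    have ha : 0 < x p.1 - y p.1 := sub_pos.2 hp1
    rw [← ENNReal.ofReal_mul (inv_nonneg.2 hb.le),
      ← ENNReal.ofReal_mul (sub_nonneg.2 (inv_anti₀ ha (by linarith)))]
    congr 1
    field_simp
    ring
  have key2 : ENNReal.ofReal ((y p.2 - x p.2)⁻¹ - (y p.2 - y p.1)⁻¹) *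
      ENNReal.ofReal (y p.2 - x p.2) =
      ENNReal.ofReal (y p.2 - y p.1)⁻¹ * ENNReal.ofReal (x p.2 - y p.1) := by
    have ha : 0 < y p.2 - x p.2 := sub_pos.2 hp3
    rw [← ENNReal.ofReal_mul (inv_nonneg.2 hb.le),
      ← ENNReal.ofReal_mul (sub_nonneg.2 (inv_anti₀ ha (by linarith)))]
    congr 1
    field_simp
    ring
  have z1 : ENNReal.ofReal (y p.1 - x p.1) = 0 := ENNReal.ofReal_eq_zero.2 (by linarith)
  have z2 : ENNReal.ofReal (x p.1 - y p.2) = 0 := ENNReal.ofReal_eq_zero.2 (by linarith)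
  have z3 : ENNReal.ofReal (y p.1 - x p.2) = 0 := ENNReal.ofReal_eq_zero.2 (by linarith)
  have z4 : ENNReal.ofReal (x p.2 - y p.2) = 0 := ENNReal.ofReal_eq_zero.2 (by linarith)
  by_cases s1 : x p.1 ∈ S <;> by_cases s2 : x p.2 ∈ S <;>
    simp [indicator, s1, s2, z1, z2, z3, z4, key1, key2]

/-- A one-dimensional form of **Strassen's theorem**: two laws with equal means and ordered expected
shortfalls are the marginals of a martingale pair. -/
theorem exists_martingale_coupling {P Q : Measure ℝ} [IsProbabilityMeasure P]
    [IsProbabilityMeasure Q] (hP : Integrable id P) (hQ : Integrable id Q)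
    (hmean : ∫ t, t ∂P = ∫ t, t ∂Q)
    (hput : ∀ k, ∫ t, max (k - t) 0 ∂P ≤ ∫ t, max (k - t) 0 ∂Q) :
    ∃ π : Measure (ℝ × ℝ), π.map Prod.fst = P ∧ π.map Prod.snd = Q ∧
      ∀ S, MeasurableSet S → ∫ p in Prod.fst ⁻¹' S, (p.2 - p.1) ∂π = 0 := by
  have hx := measurable_quantile P
  have hy := measurable_quantile Q
  have hxP := map_quantile P
  have hyQ := map_quantile Q
  have hxi : Integrable (quantile P) unifIoo := by
    rw [← hxP] at hP
    exact hP.comp_measurable hx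
  have hyi : Integrable (quantile Q) unifIoo := by
    rw [← hyQ] at hQ
    exact hQ.comp_measurable hy
  obtain ⟨σ, h1, h2, hle⟩ := exists_coupling_excess (P := P) (Q := Q) hxi hyi
    (by
      rw [← hxP, ← hyQ, integral_map hx.aemeasurable (by fun_prop),
        integral_map hy.aemeasurable (by fun_prop)] at hmean
      exact hmean)
    (fun k => by
      have := hput k
      rw [← hxP, ← hyQ, integral_map hx.aemeasurable (by fun_prop),
        integral_map hy.aemeasurable (by fun_prop)] at this
      exact this)
  set x := quantile P
  set y := quantile Q
  have hfst : ∀ᵐ p ∂σ, p.1 ∈ Ioo (0 : ℝ) 1 ∧ y p.1 < x p.1 := by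
    have : ∀ᵐ u ∂σ.map Prod.fst, u ∈ Ioo (0 : ℝ) 1 ∧ y u < x u := by
      rw [h1, ae_withDensity_iff (by fun_prop)]
      filter_upwards [ae_unifIoo_mem] with u hu h
      exact ⟨hu, by simpa using h⟩
    exact ae_of_ae_map measurable_fst.aemeasurable this
  have hsnd : ∀ᵐ p ∂σ, p.2 ∈ Ioo (0 : ℝ) 1 ∧ x p.2 < y p.2 := by
    have : ∀ᵐ u ∂σ.map Prod.snd, u ∈ Ioo (0 : ℝ) 1 ∧ x u < y u := by
      rw [h2, ae_withDensity_iff (by fun_prop)]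
      filter_upwards [ae_unifIoo_mem] with u hu h
      exact ⟨hu, by simpa using h⟩
    exact ae_of_ae_map measurable_snd.aemeasurable this
  have hσ : ∀ᵐ p ∂σ, y p.1 < x p.1 ∧ x p.1 ≤ x p.2 ∧ x p.2 < y p.2 := by
    filter_upwards [hfst, hsnd, hle] with p hp1 hp2 hp
    exact ⟨hp1.2, quantile_monotoneOn P hp1.1 hp2.1 hp, hp2.2⟩
  have hm1 := (map_fst_exchangeLaw hx hy h1 h2 hσ).trans hxP
  have hm2 := (map_snd_exchangeLaw hx hy h1 h2 hσ).trans hyQ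
  refine ⟨exchangeLaw unifIoo σ x y, hm1, hm2, fun S hS => ?_⟩
  have i1 : Integrable (fun p : ℝ × ℝ => p.1) (exchangeLaw unifIoo σ x y) := by
    rw [← hm1] at hP
    exact hP.comp_measurable measurable_fst
  have i2 : Integrable (fun p : ℝ × ℝ => p.2) (exchangeLaw unifIoo σ x y) := by
    rw [← hm2] at hQ
    exact hQ.comp_measurable measurable_snd
  refine (integral_eq_zero_iff_lintegral_eq (i2.sub i1).restrict).2 ?_
  simpa using setLIntegral_exchangeLaw_balance hx hy hσ hS

end Coupling

/-! ### Extended expectations and the two stochastic orders -/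

section Orders

open Set

variable {Ω : Type*} [MeasurableSpace Ω] {μ : Measure Ω} {X Y W Z : Ω → ℝ}

lemma extExpectation_eq_integral {f : Ω → ℝ} (hf : Integrable f μ) :
    extExpectation μ f = ((∫ ω, f ω ∂μ : ℝ) : EReal) := by
  have h1 : ∫⁻ ω, ENNReal.ofReal (f ω) ∂μ ≠ ⊤ := hf.lintegral_lt_top.ne
  have h2 : ∫⁻ ω, ENNReal.ofReal (-f ω) ∂μ ≠ ⊤ := hf.neg.lintegral_lt_top.ne
  rw [integral_eq_lintegral_pos_part_sub_lintegral_neg_part hf, extExpectation, EReal.coe_sub,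
    EReal.coe_ennreal_toReal h1, EReal.coe_ennreal_toReal h2]

lemma extExpectation_neg {f : Ω → ℝ} (h : ∫⁻ ω, ENNReal.ofReal (-f ω) ∂μ ≠ ⊤) :
    extExpectation μ (fun ω => -f ω) = -extExpectation μ f := by
  rw [extExpectation, extExpectation, EReal.neg_sub]
  · simp [sub_eq_add_neg, add_comm]
  · exact Or.inl (EReal.coe_ennreal_ne_bot _)
  · exact Or.inr (by simpa using h)

lemma ConvexOn.continuous_of_univ {u : ℝ → ℝ} (hu : ConvexOn ℝ univ u) : Continuous u :=
  continuousOn_univ.1 (hu.continuousOn isOpen_univ)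

/-- The negative part of a convex function of an integrable variable is integrable. -/
lemma ConvexOn.lintegral_neg_lt_top [IsFiniteMeasure μ] {u : ℝ → ℝ} (hu : ConvexOn ℝ univ u)
    (hX : Integrable X μ) : ∫⁻ ω, ENNReal.ofReal (-u (X ω)) ∂μ < ⊤ := by
  obtain ⟨c, d, h⟩ := hu.exists_affine_le_real isClosed_univ
    (hu.continuous_of_univ.lowerSemicontinuous.lowerSemicontinuousOn _)
  refine lt_of_le_of_lt (lintegral_mono fun ω => ENNReal.ofReal_le_ofReal
    (neg_le_neg (h (X ω) trivial))) ?_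
  exact ((hX.const_mul c).add (integrable_const d)).neg.lintegral_lt_top

lemma extExpectation_comp_eq {u : ℝ → ℝ} (hu : Measurable u) (h : IdentDistrib X Y μ μ) :
    extExpectation μ (fun ω => u (X ω)) = extExpectation μ (fun ω => u (Y ω)) := by
  have h1 := (h.comp (u := fun t => ENNReal.ofReal (u t)) (by fun_prop)).lintegral_eq
  have h2 := (h.comp (u := fun t => ENNReal.ofReal (-u t)) (by fun_prop)).lintegral_eq
  simp only [Function.comp_def] at h1 h2
  rw [extExpectation, extExpectation, h1, h2]

lemma CxLe.ssdGe [IsFiniteMeasure μ] (h : CxLe μ X Y) (hX : Integrable X μ)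
    (hY : Integrable Y μ) : SSDGe μ X Y := by
  intro u _ hu
  have hu' : ConvexOn ℝ univ (fun t => -u t) := hu.neg
  have key := h _ hu'
  have e : ∀ V : Ω → ℝ, Integrable V μ → extExpectation μ (fun ω => u (V ω)) =
      -extExpectation μ (fun ω => -u (V ω)) := fun V hV => by
    rw [← extExpectation_neg (hu'.lintegral_neg_lt_top hV).ne]
    simp
  rw [e X hX, e Y hY]
  exact EReal.neg_le_neg_iff.2 key

lemma CxLe.integral_eq (h : CxLe μ X Y) (hX : Integrable X μ) (hY : Integrable Y μ) :
    ∫ ω, X ω ∂μ = ∫ ω, Y ω ∂μ := by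
  refine le_antisymm ?_ ?_
  · have := h id (convexOn_id convex_univ)
    simp only [id] at this
    rwa [extExpectation_eq_integral hX, extExpectation_eq_integral hY, EReal.coe_le_coe_iff] at this
  · have := h (fun t => -t) (concaveOn_id convex_univ).neg
    rwa [extExpectation_eq_integral (f := fun ω => -X ω) hX.neg,
      extExpectation_eq_integral (f := fun ω => -Y ω) hY.neg,
      EReal.coe_le_coe_iff, integral_neg, integral_neg, neg_le_neg_iff] at this

lemma SSDGe.integral_shortfall_le [IsFiniteMeasure μ] (h : SSDGe μ X Y) (hX : Integrable X μ)
    (hY : Integrable Y μ) (k : ℝ) :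
    ∫ ω, max (k - X ω) 0 ∂μ ≤ ∫ ω, max (k - Y ω) 0 ∂μ := by
  have hmono : Monotone fun t : ℝ => -max (k - t) 0 := fun s t hst =>
    neg_le_neg (max_le_max (sub_le_sub_left hst k) le_rfl)
  have hconc : ConcaveOn ℝ univ fun t : ℝ => -max (k - t) 0 :=
    (((convexOn_const k convex_univ).sub (concaveOn_id convex_univ)).sup
      (convexOn_const 0 convex_univ)).neg
  have key := h _ hmono hconc
  have iX : Integrable (fun ω => max (k - X ω) 0) μ := ((integrable_const k).sub hX).pos_part
  have iY : Integrable (fun ω => max (k - Y ω) 0) μ := ((integrable_const k).sub hY).pos_part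
  rwa [extExpectation_eq_integral (f := fun ω => -max (k - X ω) 0) iX.neg,
    extExpectation_eq_integral (f := fun ω => -max (k - Y ω) 0) iY.neg,
    EReal.coe_le_coe_iff, integral_neg, integral_neg, neg_le_neg_iff] at key

/-! ### Conditional expectations of the increment -/

lemma condExpEvent_eq {A : Set Ω} :
    condExpEvent μ Z A = (μ A).toReal⁻¹ * ∫ ω in A, Z ω ∂μ := by
  rw [condExpEvent, ProbabilityTheory.cond, integral_smul_measure, ENNReal.toReal_inv, smul_eq_mul]

lemma setIntegral_nonpos_of_condExpEvent [IsFiniteMeasure μ] {A : Set Ω}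
    (h : 0 < μ A → condExpEvent μ Z A ≤ 0) : ∫ ω in A, Z ω ∂μ ≤ 0 := by
  rcases eq_or_ne (μ A) 0 with h0 | h0
  · rw [setIntegral_measure_zero _ h0]
  · have hpos : 0 < (μ A).toReal⁻¹ := inv_pos.2 (ENNReal.toReal_pos h0 (measure_ne_top _ _))
    have := h (pos_iff_ne_zero.2 h0)
    rw [condExpEvent_eq] at this
    exact nonpos_of_mul_nonpos_right this hpos

lemma setIntegral_nonneg_of_condExpEvent [IsFiniteMeasure μ] {A : Set Ω}
    (h : 0 < μ A → 0 ≤ condExpEvent μ Z A) : 0 ≤ ∫ ω in A, Z ω ∂μ := by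
  rcases eq_or_ne (μ A) 0 with h0 | h0
  · rw [setIntegral_measure_zero _ h0]
  · have hpos : 0 < (μ A).toReal⁻¹ := inv_pos.2 (ENNReal.toReal_pos h0 (measure_ne_top _ _))
    have := h (pos_iff_ne_zero.2 h0)
    rw [condExpEvent_eq] at this
    exact nonneg_of_mul_nonneg_right this hpos

lemma setIntegral_eq_zero_of_condExpGiven [IsFiniteMeasure μ] (hW : Measurable W)
    (hZ : Integrable Z μ) (h : condExpGiven μ Z W =ᵐ[μ] 0) {S : Set ℝ} (hS : MeasurableSet S) :
    ∫ ω in W ⁻¹' S, Z ω ∂μ = 0 := by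
  rw [← setIntegral_condExp hW.comap_le hZ ⟨S, hS, rfl⟩]
  exact integral_eq_zero_of_ae (ae_restrict_of_ae h)

/-- Adding an increment `Z` whose mean over an event `{W < k} ⊆ A ⊆ {W ≤ k}` is not positive
raises the expected shortfall below `k`. -/
lemma integral_shortfall_le_add [IsFiniteMeasure μ] (hW : Integrable W μ) (hZ : Integrable Z μ)
    {k : ℝ} {A : Set Ω} (hA : MeasurableSet A) (hle : ∀ ω ∈ A, W ω ≤ k) (hge : ∀ ω ∉ A, k ≤ W ω)
    (hAZ : ∫ ω in A, Z ω ∂μ ≤ 0) :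
    ∫ ω, max (k - W ω) 0 ∂μ ≤ ∫ ω, max (k - (W + Z) ω) 0 ∂μ := by
  have i1 : Integrable (fun ω => max (k - W ω) 0) μ := ((integrable_const k).sub hW).pos_part
  have i2 : Integrable (fun ω => max (k - (W + Z) ω) 0) μ :=
    ((integrable_const k).sub (hW.add hZ)).pos_part
  have i3 : Integrable (A.indicator Z) μ := hZ.indicator hA
  have key : ∫ ω, max (k - W ω) 0 ∂μ ≤ ∫ ω, (max (k - (W + Z) ω) 0 + A.indicator Z ω) ∂μ := by
    refine integral_mono i1 (i2.add i3) fun ω => ?_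
    by_cases hω : ω ∈ A
    · simp only [indicator_of_mem hω, Pi.add_apply]
      rw [max_eq_left (sub_nonneg.2 (hle ω hω))]
      linarith [le_max_left (k - (W ω + Z ω)) 0]
    · simp only [indicator_of_notMem hω, add_zero]
      rw [max_eq_right (sub_nonpos.2 (hge ω hω))]
      exact le_max_right _ _
  rw [integral_add i2 i3, integral_indicator hA] at key
  linarith

/-- Equality of means and the order of shortfalls pass from the pair `W`, `W + Z` to any variables
with the same laws. -/
lemma shortfall_order_of_identDistrib (hW : Integrable W μ) (hZ : Integrable Z μ)
    (hY : IdentDistrib Y (W + Z) μ μ) (hX : IdentDistrib W X μ μ) (h0 : ∫ ω, Z ω ∂μ = 0)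
    (h : ∀ k, ∫ ω, max (k - W ω) 0 ∂μ ≤ ∫ ω, max (k - (W + Z) ω) 0 ∂μ) :
    ∫ ω, X ω ∂μ = ∫ ω, Y ω ∂μ ∧ ∀ k, ∫ ω, max (k - X ω) 0 ∂μ ≤ ∫ ω, max (k - Y ω) 0 ∂μ := by
  refine ⟨?_, fun k => ?_⟩
  · rw [hY.integral_eq, ← hX.integral_eq, integral_add' hW hZ, h0, add_zero]
  · have e1 := (hY.comp (u := fun t => max (k - t) 0) (by fun_prop)).integral_eq
    have e2 := (hX.comp (u := fun t => max (k - t) 0) (by fun_prop)).integral_eq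
    simp only [Function.comp_def] at e1 e2
    rw [e1, ← e2]
    exact h k

/-- A martingale pair is increasing in convex order, by the conditional Jensen inequality. -/
lemma cxLe_add_of_condExpGiven_eq_zero [IsProbabilityMeasure μ] (hW : InL1 μ W) (hZ : InL1 μ Z)
    (h : condExpGiven μ Z W =ᵐ[μ] 0) : CxLe μ W (W + Z) := by
  intro u hu
  have hV : Integrable (W + Z) μ := hW.2.add hZ.2
  have huc := hu.continuous_of_univ
  have hm : MeasurableSpace.comap W (inferInstance : MeasurableSpace ℝ) ≤ ‹MeasurableSpace Ω› :=
    hW.1.comap_le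
  have hnegV := hu.lintegral_neg_lt_top hV
  have integrable_of {V : Ω → ℝ} (hVm : Measurable V) (hVi : Integrable V μ)
      (hpos : ∫⁻ ω, ENNReal.ofReal (u (V ω)) ∂μ < ⊤) : Integrable (fun ω => u (V ω)) μ := by
    refine ⟨(huc.measurable.comp hVm).aestronglyMeasurable, ?_⟩
    rw [hasFiniteIntegral_iff_norm]
    have : ∀ ω, ENNReal.ofReal ‖u (V ω)‖ =
        ENNReal.ofReal (u (V ω)) + ENNReal.ofReal (-u (V ω)) := fun ω => by
      rcases le_total 0 (u (V ω)) with h | h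
      · rw [Real.norm_of_nonneg h, ENNReal.ofReal_eq_zero.2 (neg_nonpos.2 h), add_zero]
      · rw [Real.norm_of_nonpos h, ENNReal.ofReal_eq_zero.2 h, zero_add]
    simp only [this]
    rw [lintegral_add_left (f := fun ω => ENNReal.ofReal (u (V ω)))
      (huc.measurable.comp hVm).ennreal_ofReal]
    exact ENNReal.add_lt_top.2 ⟨hpos, hu.lintegral_neg_lt_top hVi⟩
  by_cases htop : ∫⁻ ω, ENNReal.ofReal (u ((W + Z) ω)) ∂μ = ⊤
  · have : extExpectation μ (fun ω => u ((W + Z) ω)) = ⊤ := by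
      rw [extExpectation, htop, EReal.coe_ennreal_top,
        ← EReal.coe_ennreal_toReal hnegV.ne, EReal.top_sub_coe]
    rw [this]
    exact le_top
  have hiV : Integrable (u ∘ (W + Z)) μ :=
    integrable_of (hW.1.add hZ.1) hV (lt_top_iff_ne_top.2 htop)
  have hcond : μ[W + Z | MeasurableSpace.comap W (inferInstance : MeasurableSpace ℝ)]
      =ᵐ[μ] W := by
    refine (condExp_add hW.2 hZ.2 _).trans ?_
    rw [condExp_of_stronglyMeasurable hm (comap_measurable W).stronglyMeasurable hW.2]
    filter_upwards [h] with ω hω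
    change W ω + condExpGiven μ Z W ω = W ω
    rw [hω, Pi.zero_apply, add_zero]
  have hle : ∀ᵐ ω ∂μ, u (W ω) ≤
      (μ[u ∘ (W + Z) | MeasurableSpace.comap W (inferInstance : MeasurableSpace ℝ)]) ω := by
    filter_upwards [hu.map_condExp_le_of_finiteDimensional hm hV hiV, hcond] with ω h1 h2
    rwa [Function.comp_apply, h2] at h1
  have hiW : Integrable (fun ω => u (W ω)) μ := by
    refine integrable_of hW.1 hW.2 (lt_of_le_of_lt (lintegral_mono_ae ?_)
      (integrable_condExp (m := MeasurableSpace.comap W (inferInstance : MeasurableSpace ℝ))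
        (f := u ∘ (W + Z)) (μ := μ)).lintegral_lt_top)
    filter_upwards [hle] with ω hω using ENNReal.ofReal_le_ofReal hω
  have hfin := integral_mono_ae hiW integrable_condExp hle
  rw [integral_condExp hm] at hfin
  rw [extExpectation_eq_integral hiW,
    extExpectation_eq_integral (f := fun ω => u ((W + Z) ω)) hiV]
  exact EReal.coe_le_coe_iff.2 hfin

/-- The martingale coupling of the laws of `X` and `Y`, realized on the given atomless space. -/
lemma exists_martingale_of_shortfall_order [IsProbabilityMeasure μ] (hμ : Atomless μ)
    (hX : InL1 μ X) (hY : InL1 μ Y) (hmean : ∫ ω, X ω ∂μ = ∫ ω, Y ω ∂μ)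
    (h : ∀ k, ∫ ω, max (k - X ω) 0 ∂μ ≤ ∫ ω, max (k - Y ω) 0 ∂μ) :
    ∃ W Z : Ω → ℝ, InL1 μ W ∧ InL1 μ Z ∧ IdentDistrib Y (W + Z) μ μ ∧ IdentDistrib W X μ μ ∧
        condExpGiven μ Z W =ᵐ[μ] 0 := by
  have hXm := hX.1.aemeasurable (μ := μ)
  have hYm := hY.1.aemeasurable (μ := μ)
  have : IsProbabilityMeasure (μ.map X) := Measure.isProbabilityMeasure_map hXm
  have : IsProbabilityMeasure (μ.map Y) := Measure.isProbabilityMeasure_map hYm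
  obtain ⟨π, h1, h2, hπ⟩ := exists_martingale_coupling (P := μ.map X) (Q := μ.map Y)
    ((integrable_map_measure (by fun_prop) hXm).2 hX.2)
    ((integrable_map_measure (by fun_prop) hYm).2 hY.2)
    (by rwa [integral_map hXm (by fun_prop), integral_map hYm (by fun_prop)])
    (fun k => by
      rw [integral_map hXm (by fun_prop), integral_map hYm (by fun_prop)]
      exact h k)
  have : IsProbabilityMeasure π := by
    have hp : IsProbabilityMeasure (π.map Prod.fst) := by rw [h1]; infer_instance
    exact Measure.isProbabilityMeasure_of_map (f := Prod.fst)
  obtain ⟨f, hf, hfπ⟩ := hμ.exists_map_eq π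
  have hW : Measurable fun ω => (f ω).1 := hf.fst
  have hV : Measurable fun ω => (f ω).2 := hf.snd
  have idW : IdentDistrib (fun ω => (f ω).1) X μ μ :=
    ⟨hW.aemeasurable, hXm, by
      rw [← h1, ← hfπ, Measure.map_map measurable_fst hf]; rfl⟩
  have idV : IdentDistrib Y (fun ω => (f ω).2) μ μ :=
    ⟨hYm, hV.aemeasurable, by
      rw [← h2, ← hfπ, Measure.map_map measurable_snd hf]; rfl⟩
  have iW : Integrable (fun ω => (f ω).1) μ := idW.integrable_iff.2 hX.2
  have iV : Integrable (fun ω => (f ω).2) μ := idV.integrable_iff.1 hY.2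
  refine ⟨fun ω => (f ω).1, fun ω => (f ω).2 - (f ω).1, ⟨hW, iW⟩, ⟨hV.sub hW, iV.sub iW⟩, ?_,
    idW, ?_⟩
  · have : ((fun ω => (f ω).1) + fun ω => (f ω).2 - (f ω).1) = fun ω => (f ω).2 := by
      ext ω; simp
    rwa [this]
  · refine (ae_eq_condExp_of_forall_setIntegral_eq (g := 0) hW.comap_le (iV.sub iW)
      (fun _ _ _ => integrableOn_zero) ?_ aestronglyMeasurable_zero).symm
    rintro _ ⟨S, hS, rfl⟩ -
    have key := hπ S hS
    rw [← hfπ, setIntegral_map (measurable_fst hS) (by fun_prop) hf.aemeasurable] at key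
    simpa using! key.symm

end Orders

theorem corollary2 {Ω : Type*} [MeasurableSpace Ω] (μ : Measure Ω) [IsProbabilityMeasure μ]
    (hμ : Atomless μ) (X Y : Ω → ℝ) (hX : InL1 μ X) (hY : InL1 μ Y) :
    List.TFAE [
      CxLe μ X Y,
      SSDGe μ X Y ∧ ∫ ω, X ω ∂μ = ∫ ω, Y ω ∂μ,
      ∃ W Z : Ω → ℝ, InL1 μ W ∧ InL1 μ Z ∧ IdentDistrib Y (W + Z) μ μ ∧ IdentDistrib W X μ μ ∧
        condExpGiven μ Z W =ᵐ[μ] 0,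
      ∃ W Z : Ω → ℝ, InL1 μ W ∧ InL1 μ Z ∧ IdentDistrib Y (W + Z) μ μ ∧ IdentDistrib W X μ μ ∧
        ∫ ω, Z ω ∂μ = 0 ∧
        ∀ x : ℝ, 0 < μ {ω | W ω ≤ x} → condExpEvent μ Z {ω | W ω ≤ x} ≤ 0,
      ∃ W Z : Ω → ℝ, InL1 μ W ∧ InL1 μ Z ∧ IdentDistrib Y (W + Z) μ μ ∧ IdentDistrib W X μ μ ∧
        ∫ ω, Z ω ∂μ = 0 ∧
        ∀ x : ℝ, 0 < μ {ω | W ω ≥ x} → 0 ≤ condExpEvent μ Z {ω | W ω ≥ x}] := by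
  tfae_have 1 → 2 := fun h => ⟨h.ssdGe hX.2 hY.2, h.integral_eq hX.2 hY.2⟩
  tfae_have 2 → 3 := fun h =>
    exists_martingale_of_shortfall_order hμ hX hY h.2 (h.1.integral_shortfall_le hX.2 hY.2)
  tfae_have 3 → 1 := by
    rintro ⟨W, Z, hW, hZ, hYd, hXd, hc⟩ u hu
    have hum := hu.continuous_of_univ.measurable
    rw [← extExpectation_comp_eq hum hXd, extExpectation_comp_eq hum hYd]
    exact cxLe_add_of_condExpGiven_eq_zero hW hZ hc u hu
  have hzero {W Z : Ω → ℝ} (hW : InL1 μ W) (hZ : InL1 μ Z) (hc : condExpGiven μ Z W =ᵐ[μ] 0)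
      {S : Set ℝ} (hS : MeasurableSet S) : ∫ ω in W ⁻¹' S, Z ω ∂μ = 0 :=
    setIntegral_eq_zero_of_condExpGiven hW.1 hZ.2 hc hS
  tfae_have 3 → 4 := by
    rintro ⟨W, Z, hW, hZ, hYd, hXd, hc⟩
    refine ⟨W, Z, hW, hZ, hYd, hXd, by simpa using hzero hW hZ hc MeasurableSet.univ,
      fun x _ => ?_⟩
    rw [condExpEvent_eq]
    exact (mul_eq_zero_of_right _ (hzero hW hZ hc measurableSet_Iic)).le
  tfae_have 3 → 5 := by
    rintro ⟨W, Z, hW, hZ, hYd, hXd, hc⟩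
    refine ⟨W, Z, hW, hZ, hYd, hXd, by simpa using hzero hW hZ hc MeasurableSet.univ,
      fun x _ => ?_⟩
    rw [condExpEvent_eq]
    exact (mul_eq_zero_of_right _ (hzero hW hZ hc measurableSet_Ici)).ge
  tfae_have 4 → 3 := by
    rintro ⟨W, Z, hW, hZ, hYd, hXd, h0, hc⟩
    obtain ⟨hm, hp⟩ := shortfall_order_of_identDistrib hW.2 hZ.2 hYd hXd h0 fun k =>
      integral_shortfall_le_add hW.2 hZ.2 (A := {ω | W ω ≤ k})
        (measurableSet_le hW.1 measurable_const) (fun ω hω => hω) (fun ω hω => (not_le.1 hω).le)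
        (setIntegral_nonpos_of_condExpEvent (hc k))
    exact exists_martingale_of_shortfall_order hμ hX hY hm hp
  tfae_have 5 → 3 := by
    rintro ⟨W, Z, hW, hZ, hYd, hXd, h0, hc⟩
    obtain ⟨hm, hp⟩ := shortfall_order_of_identDistrib hW.2 hZ.2 hYd hXd h0 fun k => by
      -- As `E[Z] = 0`, the condition on `{W ≥ k}` is one on the complement `{W < k}`.
      have hA : MeasurableSet {ω | W ω ≥ k} := measurableSet_le measurable_const hW.1
      refine integral_shortfall_le_add hW.2 hZ.2 (A := {ω | W ω ≥ k}ᶜ) hA.compl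
        (fun ω (hω : ¬k ≤ W ω) => (not_le.1 hω).le) (fun ω hω => not_not.1 hω) ?_
      have := integral_add_compl hA hZ.2
      linarith [setIntegral_nonneg_of_condExpEvent (hc k)]
    exact exists_martingale_of_shortfall_order hμ hX hY hm hp
  tfae_finish
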